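/- For an integrable or square-integrable function $f\colon\mathbb R\to\mathbb C$ let $\hat f$ denote its Fourier transform, normalised as $\hat f(\omega)=\int_{-\infty}^{\infty} f(t)e^{-i\omega t}\,dt$ (understood in the $L^2$ sense for square-integrable $f$), let $z^*$ denote the complex conjugate of $z \in \mathbb C$, and let $L^2(\mathbb R)$ be the Hilbert space of complex-valued square-integrable functions on $\mathbb R$. Let $\Phi\colon\mathbb R\to\mathbb R$ be continuous and integrable and suppose that $r(t,u)=\Phi(t-u)$ is a symmetric positive-semidefinite kernel on $\mathbb R$, that is, $r(t,u)=r(u,t)$ and $\sum_{i,j} c_i c_j\, r(t_i,t_j)\ge 0$ for all finitely many points $t_i\in\mathbb R$ and coefficients $c_i\in\mathbb R$. (Then $\hat\Phi$ is real-valued and non-negative.) Suppose moreover that $\hat\Phi(\omega)\neq 0$ for almost every $\omega\in\mathbb R$. Let $\mathcal H_r(\mathbb R)$ be the reproducing kernel Hilbert space of complex-valued functions on $\mathbb R$ with kernel $r$. Let $\{\varphi_m\}_{m\in I}$ be an orthonormal basis of $L^2(\mathbb R)$, and let $h\colon\mathbb R\to\mathbb C$ be an integrable or square-integrable function such that $|\hat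 h(\omega)|=\hat\Phi(\omega)^{1/2}$ for almost every $\omega \in \mathbb R$. Then: 1. For every $m\in I$ and every $t\in\mathbb R$ the integral $$\psi_m(t)=\int_{-\infty}^{\infty}h(t-\tau)\varphi_m(\tau)\,d\tau$$ converges absolutely. Moreover $\psi_m\in L^2(\mathbb R)$, and $\hat\psi_m(\omega)=\hat h(\omega)\hat\varphi_m(\omega)$ for almost every $\omega\in\mathbb R$. 2. The functions $\{\psi_m\}_{m\in I}$ form an orthonormal basis of $\mathcal H_r(\mathbb R)$. 3. The kernel has the pointwise convergent expansion $$r(t,u)=\sum_{m\in I}\psi_m^*(t)\,\psi_m(u)\qquad\text{for all } t,u\in\mathbb R.$$ -/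

import Mathlib

open MeasureTheory FourierTransform
open scoped ComplexConjugate

noncomputable section

/-- The Fourier transform `f̂(ω) = ∫ f(t) e^{-iωt} dt` of an integrable function. -/
def fourierL1 (f : ℝ → ℂ) (ω : ℝ) : ℂ :=
  ∫ t : ℝ, f t * Complex.exp (-(Complex.I * (ω : ℂ) * (t : ℂ)))

/-- The Fourier transform of a square-integrable function (defined almost everywhere), in the
same normalisation `e^{-iωt}`. Mathlib's Fourier transform on `L²` extends
`∫ f(t) e^{-2πitξ} dt`, hence the substitution `ξ = ω / (2π)`. -/
def fourierL2 (f : ℝ → ℂ) (hf : MemLp f 2 (volume : Measure ℝ)) (ω : ℝ) : ℂ :=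
  (𝓕 (hf.toLp f) : Lp ℂ 2 (volume : Measure ℝ)) (ω / (2 * Real.pi))

open Classical in
/-- The Fourier transform of an integrable or square-integrable function; where both definitions
apply they agree almost everywhere. (The value `0` in the remaining case is a default.) -/
def fourierHat (f : ℝ → ℂ) : ℝ → ℂ :=
  if Integrable f (volume : Measure ℝ) then fourierL1 f
  else if hf : MemLp f 2 (volume : Measure ℝ) then fourierL2 f hf
  else 0

/-- The convolution `t ↦ ∫ h(t - τ) f(τ) dτ`. -/
def convolve (h f : ℝ → ℂ) (t : ℝ) : ℂ :=
  ∫ τ : ℝ, h (t - τ) * f τ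

/-- A real-valued kernel `r`, viewed as a kernel with values in the operators on `ℂ`
(multiplication by `r(t, u)`), which is the form in which Mathlib describes the kernel of a
reproducing kernel Hilbert space of complex-valued functions. -/
def complexKernel (r : Matrix ℝ ℝ ℝ) : Matrix ℝ ℝ (ℂ →L[ℂ] ℂ) :=
  Matrix.of fun t u => (r t u : ℂ) • ContinuousLinearMap.id ℂ ℂ

open scoped ComplexOrder in
theorem complexKernel_posSemidef {r : Matrix ℝ ℝ ℝ} (hr : r.PosSemidef) :
    (complexKernel r).PosSemidef := by
  have hs : ∀ t u, r t u = r u t := fun t u => by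
    simpa using (hr.isHermitian.apply u t)
  have key := (RKHS.posSemidef_tfae (K := complexKernel r)).out 0 2
  refine key.mpr ⟨?_, fun v => ?_⟩
  · ext t u
    have hid : ContinuousLinearMap.adjoint (ContinuousLinearMap.id ℂ ℂ)
        = ContinuousLinearMap.id ℂ ℂ := star_one (ℂ →L[ℂ] ℂ)
    simp [hid, complexKernel, Matrix.conjTranspose_apply, hs t u, ContinuousLinearMap.star_eq_adjoint]
  · have h1 := hr.2 (v.mapRange Complex.re rfl)
    have h2 := hr.2 (v.mapRange Complex.im rfl)
    rw [Finsupp.sum_mapRange_index (by simp)] at h1 h2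
    simp only [Finsupp.sum_mapRange_index, mul_zero, implies_true, star_trivial]
      at h1 h2
    have h := add_nonneg h1 h2
    simp only [Finsupp.sum, ← Finset.sum_add_distrib] at h
    simp only [Finsupp.sum, map_sum]
    refine h.trans_eq (Finset.sum_congr rfl fun x _ => Finset.sum_congr rfl fun y _ => ?_)
    simp [complexKernel, hs y x]
    ring

/-- Every symmetric positive semidefinite kernel has a reproducing kernel Hilbert space. -/
theorem exists_rkhs {r : Matrix ℝ ℝ ℝ} (hr : r.PosSemidef) :
    ∃ (H : Type) (_ : NormedAddCommGroup H) (_ : InnerProductSpace ℂ H) (_ : CompleteSpace H)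
      (_ : RKHS ℂ H ℝ ℂ), RKHS.kernel H = complexKernel r := by
  have : Fact (complexKernel r).PosSemidef := ⟨complexKernel_posSemidef hr⟩
  exact ⟨RKHS.OfKernel (complexKernel r), inferInstance, inferInstance, inferInstance,
    inferInstance, RKHS.OfKernel.kernel_ofKernel⟩

end

section

open Filter Topology
open scoped SchwartzMap InnerProductSpace

/-! Let `k_t(τ) = conj (h (t - τ))` in `L²`, so that `(h * f)(t) = ⟪k_t, f⟫`. By Plancherel `⟪k_t,
k_u⟫` is the inverse transform of `|ĥ|² = Φ̂` at `t - u`, which is `Φ(t - u) = r(t, u)` by Fourier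
inversion. Since `ĥ ≠ 0` a.e., the `k_t` span a dense subspace, so matching them with the kernel
functions of the RKHS gives a unitary `U` (`exists_linearIsometryEquiv_of_inner_eq`). By the
reproducing property `U f = h * f`, so `ψ_m = U φ_m` is an orthonormal basis; the expansion is
Parseval for `⟪k_u, k_t⟫`.

Inversion needs `Φ̂` integrable. Positive semidefiniteness gives `Φ̂ ≥ 0`
(`fourier_nonneg_of_inner_eq`), and Gaussian summation with Fatou then bounds `∫ Φ̂`
(`integrable_fourier_of_nonneg`). Hence `h` is in `L²` even when only assumed integrable, and since
`Φ̂` is bounded, multiplication by `ĥ` preserves `L²`. -/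

/-! ### Compatibility of the `L¹` and `L²` Fourier transforms -/

theorem ae_eq_of_integral_schwartz_mul_eq {f g : ℝ → ℂ}
    (hf : LocallyIntegrable f volume) (hg : LocallyIntegrable g volume)
    (h : ∀ φ : 𝓢(ℝ, ℂ), ∫ x, φ x * f x = ∫ x, φ x * g x) : f =ᵐ[volume] g := by
  refine ae_eq_of_integral_contDiff_smul_eq hf hg fun φ hφ hφs => ?_
  have hs : HasCompactSupport (fun x => (φ x : ℂ)) := hφs.comp_left (g := fun x : ℝ => (x : ℂ)) rfl
  simp_rw [Complex.real_smul]
  exact h (hs.toSchwartzMap (Complex.ofRealCLM.contDiff.comp hφ))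

theorem integral_schwartz_mul_fourierL2 (φ : 𝓢(ℝ, ℂ)) (f : Lp ℂ 2 (volume : Measure ℝ)) :
    ∫ x, φ x * (𝓕 f : Lp ℂ 2 (volume : Measure ℝ)) x = ∫ x, 𝓕 (φ : ℝ → ℂ) x * f x := by
  have := congrArg (fun T => T φ) (Lp.fourier_toTemperedDistribution_eq f)
  simpa [SchwartzMap.fourier_coe] using this.symm

theorem integral_mul_fourier_eq {f g : ℝ → ℂ} (hf : Integrable f) (hg : Integrable g) :
    ∫ x, g x * 𝓕 f x = ∫ x, 𝓕 g x * f x := by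
  have := (VectorFourier.integral_fourierIntegral_smul_eq_flip (L := innerₗ ℝ)
      Real.continuous_fourierChar continuous_inner hg hf)
  simpa using! this.symm

theorem continuous_fourier_of_integrable {f : ℝ → ℂ} (hf : Integrable f) : Continuous (𝓕 f) :=
  VectorFourier.fourierIntegral_continuous Real.continuous_fourierChar
    (L := innerₗ ℝ) continuous_inner hf

theorem continuous_fourierInv_of_integrable {f : ℝ → ℂ} (hf : Integrable f) :
    Continuous (𝓕⁻ f) := by
  have : 𝓕⁻ f = fun x => 𝓕 f (-x) := funext fun x => Real.fourierInv_eq_fourier_neg f x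
  rw [this]
  exact (continuous_fourier_of_integrable hf).comp continuous_neg

theorem locallyIntegrable_L2 (f : Lp ℂ 2 (volume : Measure ℝ)) : LocallyIntegrable f volume :=
  (Lp.memLp f).locallyIntegrable (by norm_num)

/-- On `L¹ ∩ L²` the two Fourier transforms agree. -/
theorem fourier_ae_eq_fourierL2 {f : ℝ → ℂ} (hf : Integrable f) (hf2 : MemLp f 2 volume) :
    𝓕 f =ᵐ[volume] (𝓕 (hf2.toLp f) : Lp ℂ 2 (volume : Measure ℝ)) := by
  refine ae_eq_of_integral_schwartz_mul_eq
    (continuous_fourier_of_integrable hf).locallyIntegrable (locallyIntegrable_L2 _) fun φ => ?_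
  rw [integral_schwartz_mul_fourierL2, integral_mul_fourier_eq hf φ.integrable]
  refine integral_congr_ae ?_
  filter_upwards [hf2.coeFn_toLp] with x hx
  rw [hx]

/-- An integrable function with square-integrable Fourier transform is square-integrable. -/
theorem memLp_two_of_fourier_memLp {f : ℝ → ℂ} (hf : Integrable f) (h : MemLp (𝓕 f) 2 volume) :
    MemLp f 2 volume := by
  -- Every Schwartz function is a Fourier transform, so `f` and the `L²` inverse transform of `𝓕 f`
  -- have the same pairings with Schwartz functions.
  let g : Lp ℂ 2 (volume : Measure ℝ) := 𝓕⁻ (h.toLp _)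
  have hg : 𝓕 g = h.toLp _ := fourier_fourierInv_eq _
  have : f =ᵐ[volume] g := by
    refine ae_eq_of_integral_schwartz_mul_eq hf.locallyIntegrable (locallyIntegrable_L2 _)
      fun φ => ?_
    have e : (φ : ℝ → ℂ) = 𝓕 ((𝓕⁻ φ : 𝓢(ℝ, ℂ)) : ℝ → ℂ) := by
      rw [← SchwartzMap.fourier_coe, fourier_fourierInv_eq]
    rw [e, ← integral_schwartz_mul_fourierL2, ← integral_mul_fourier_eq hf (𝓕⁻ φ).integrable, hg]
    refine integral_congr_ae ?_
    filter_upwards [h.coeFn_toLp] with x hx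
    rw [hx]
  exact (memLp_congr_ae this).2 (Lp.memLp g)

/-- On `L¹ ∩ L²` the two inverse Fourier transforms agree. -/
theorem fourierInv_ae_eq_fourierInvL2 {f : ℝ → ℂ} (hf : Integrable f) (hf2 : MemLp f 2 volume) :
    𝓕⁻ f =ᵐ[volume] (𝓕⁻ (hf2.toLp f) : Lp ℂ 2 (volume : Measure ℝ)) := by
  refine ae_eq_of_integral_schwartz_mul_eq
    (continuous_fourierInv_of_integrable hf).locallyIntegrable (locallyIntegrable_L2 _) fun φ => ?_
  have e : (φ : ℝ → ℂ) = 𝓕 ((𝓕⁻ φ : 𝓢(ℝ, ℂ)) : ℝ → ℂ) := by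
    rw [← SchwartzMap.fourier_coe, fourier_fourierInv_eq]
  have e' : ∫ x, φ x * 𝓕⁻ f x = ∫ x, 𝓕⁻ (φ : ℝ → ℂ) x * f x := by
    have hφ := integral_mul_fourier_eq hf (φ.integrable.comp_neg)
    rw [← integral_neg_eq_self] at hφ
    simp only [neg_neg, ← Real.fourierInv_eq_fourier_neg] at hφ
    rw [hφ, Real.fourierInv_eq_fourier_comp_neg]
  rw [e', ← SchwartzMap.fourierInv_coe, e, ← integral_schwartz_mul_fourierL2,
    fourier_fourierInv_eq]
  refine integral_congr_ae ?_
  filter_upwards [hf2.coeFn_toLp] with x hx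
  rw [hx]

/-- Both sides are continuous in `g`, so density reduces to Schwartz `g`. -/
theorem integral_mul_fourierL2_eq (f g : Lp ℂ 2 (volume : Measure ℝ)) :
    ∫ x, g x * (𝓕 f : Lp ℂ 2 (volume : Measure ℝ)) x =
      ∫ x, (𝓕 g : Lp ℂ 2 (volume : Measure ℝ)) x * f x := by
  let B := (ContinuousLinearMap.mul ℂ ℂ).lpPairing (volume : Measure ℝ) 2 2
  have hB : ∀ a b : Lp ℂ 2 (volume : Measure ℝ), B a b = ∫ x, a x * b x := fun a b => by
    simp [B, ContinuousLinearMap.lpPairing_eq_integral]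
  rw [← hB, ← hB]
  refine DenseRange.induction_on (p := fun g => B g (𝓕 f) = B (𝓕 g) f)
    (SchwartzMap.denseRange_toLpCLM (p := 2) ENNReal.ofNat_ne_top) g ?_ fun φ => ?_
  · exact isClosed_eq (B.flip (𝓕 f)).continuous
      ((B.flip f).continuous.comp (Lp.fourierTransformₗᵢ ℝ ℂ).continuous)
  · have := integral_schwartz_mul_fourierL2 φ f
    rw [hB, hB]
    simp only [SchwartzMap.toLpCLM_apply, SchwartzMap.toLp_fourier_eq]
    refine Eq.trans (integral_congr_ae ?_) (this.trans (integral_congr_ae ?_))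
    · filter_upwards [φ.coeFn_toLp 2 volume] with x hx
      rw [hx]
    · filter_upwards [(𝓕 φ).coeFn_toLp 2 volume] with x hx
      rw [hx, SchwartzMap.fourier_coe]

/-! ### Positive-definite functions have non-negative Fourier transform -/

section
variable {H : Type*} [NormedAddCommGroup H] [InnerProductSpace ℂ H]

/-- `‖K t - K u‖²` expands into values of `F`. Continuity and boundedness of `K` make the vector
integrals `∫ g t • K t` available. -/
theorem continuous_of_inner_eq {F : ℝ → ℂ} (hF : Continuous F) {K : ℝ → H}
    (hK : ∀ t u, ⟪K t, K u⟫_ℂ = F (t - u)) : Continuous K := by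
  have key : ∀ t u, ‖K t - K u‖ = √(F 0 - F (t - u) - F (u - t) + F 0).re := fun t u => by
    rw [@norm_eq_sqrt_re_inner ℂ, inner_sub_left, inner_sub_right, inner_sub_right,
      hK, hK, hK, hK]
    congr 1
    simp
    ring
  refine continuous_iff_continuousAt.2 fun u => tendsto_iff_norm_sub_tendsto_zero.2 ?_
  simp_rw [key]
  have : Continuous fun t => √(F 0 - F (t - u) - F (u - t) + F 0).re := by fun_prop
  simpa using this.tendsto u

theorem integrable_smul_of_inner_eq {F : ℝ → ℂ} (hF : Continuous F) {K : ℝ → H}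
    (hK : ∀ t u, ⟪K t, K u⟫_ℂ = F (t - u)) {g : ℝ → ℂ} (hg : Integrable g) :
    Integrable fun t => g t • K t := by
  refine hg.smul_bdd (√(F 0).re) (continuous_of_inner_eq hF hK).aestronglyMeasurable
    (.of_forall fun t => ?_)
  rw [@norm_eq_sqrt_re_inner ℂ, hK]
  simp

theorem inner_self_integral_smul [CompleteSpace H] {F : ℝ → ℂ} (hF : Continuous F) {K : ℝ → H}
    (hK : ∀ t u, ⟪K t, K u⟫_ℂ = F (t - u)) {g : ℝ → ℂ} (hg : Integrable g) :
    ⟪∫ t, g t • K t, ∫ t, g t • K t⟫_ℂ = ∫ t, ∫ u, conj (g u) * g t * F (u - t) := by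
  have hi := integrable_smul_of_inner_eq hF hK hg
  rw [← integral_inner hi]
  congr 1 with t
  rw [← inner_conj_symm, ← integral_inner hi, ← integral_conj]
  congr 1 with u
  rw [inner_conj_symm, inner_smul_left, inner_smul_right, hK]
  ring

end

theorem integrable_exp_neg_sq_add {b : ℝ} (hb : 0 < b) (s : ℝ) :
    Integrable fun t : ℝ => Real.exp (-b * (t + s) ^ 2) :=
  (integrable_exp_neg_mul_sq hb).comp_add_right s

/-- The quadratic form of the kernel `F (t - u)` at a modulated Gaussian is a positive multiple of
a Gaussian mean of the Fourier transform of `F`. -/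
theorem integral_integral_gaussian_kernel {F : ℝ → ℂ} (hF : Integrable F) (b : ℝ) (hb : 0 < b)
    (ξ : ℝ) :
    ∫ t : ℝ, ∫ u : ℝ, conj (Real.exp (-b * u ^ 2) * Complex.exp (2 * Real.pi * ξ * u * Complex.I))
        * (Real.exp (-b * t ^ 2) * Complex.exp (2 * Real.pi * ξ * t * Complex.I)) * F (u - t) =
      (∫ t : ℝ, Real.exp (-(2 * b) * t ^ 2) : ℝ) *
        ∫ s : ℝ, Complex.exp (-(b / 2 : ℝ) * ‖s‖ ^ 2) •
          (Complex.exp (-(2 * Real.pi * ξ * s * Complex.I)) * F s) := by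
  have h1 : ∀ t : ℝ,
      ∫ u : ℝ, conj (Real.exp (-b * u ^ 2) * Complex.exp (2 * Real.pi * ξ * u * Complex.I))
        * (Real.exp (-b * t ^ 2) * Complex.exp (2 * Real.pi * ξ * t * Complex.I)) * F (u - t) =
      ∫ s : ℝ, (Real.exp (-(2 * b) * (t + s / 2) ^ 2) : ℂ) *
        (Complex.exp (-(b / 2 : ℝ) * ‖s‖ ^ 2) *
          (Complex.exp (-(2 * Real.pi * ξ * s * Complex.I)) * F s)) := fun t => by
    -- Substitute `u = s + t` and complete the square: `b u² + b t² = 2b (t + s/2)² + (b/2) s²`.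
    rw [← integral_add_right_eq_self _ t]
    congr 1 with s
    have hs : (‖s‖ : ℂ) ^ 2 = (s : ℂ) ^ 2 := by
      rw [← Complex.ofReal_pow, ← Complex.ofReal_pow, Real.norm_eq_abs, sq_abs]
    simp only [map_mul, ← Complex.exp_conj, Complex.conj_ofReal, Complex.conj_I, Complex.ofReal_exp,
      map_ofNat, hs]
    simp only [add_sub_cancel_right, ← mul_assoc, ← Complex.exp_add]
    congr 2
    push_cast
    ring
  simp_rw [h1]
  have hm : Integrable fun s : ℝ => Complex.exp (-(b / 2 : ℝ) * ‖s‖ ^ 2) *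
          (Complex.exp (-(2 * Real.pi * ξ * s * Complex.I)) * F s) := by
    refine (hF.bdd_mul (c := 1) ?_ ?_).bdd_mul (c := 1) ?_ ?_
    · exact Continuous.aestronglyMeasurable (by fun_prop)
    · refine .of_forall fun s => ?_
      rw [Complex.norm_exp]
      simp
    · exact Continuous.aestronglyMeasurable (by fun_prop)
    · refine .of_forall fun s => ?_
      rw [Complex.norm_exp]
      simp only [← Complex.ofReal_pow, ← Complex.ofReal_mul, ← Complex.ofReal_neg,
        Complex.ofReal_re, Real.exp_le_one_iff]
      have : 0 ≤ b / 2 * ‖s‖ ^ 2 := by positivity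
      linarith
  rw [integral_integral_swap]
  · have h2 : ∀ s : ℝ, ∫ t : ℝ, (Real.exp (-(2 * b) * (t + s / 2) ^ 2) : ℂ) =
        (∫ t : ℝ, Real.exp (-(2 * b) * t ^ 2) : ℝ) := fun s => by
      rw [integral_complex_ofReal,
        integral_add_right_eq_self (fun t : ℝ => Real.exp (-(2 * b) * t ^ 2))]
    simp_rw [integral_mul_const, h2, integral_const_mul, smul_eq_mul]
  · have hmeas : AEStronglyMeasurable (fun p : ℝ × ℝ =>
        (Real.exp (-(2 * b) * (p.1 + p.2 / 2) ^ 2) : ℂ) *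
        (Complex.exp (-(b / 2 : ℝ) * ‖p.2‖ ^ 2) *
          (Complex.exp (-(2 * Real.pi * ξ * p.2 * Complex.I)) * F p.2)))
          ((volume : Measure ℝ).prod volume) :=
      (Continuous.aestronglyMeasurable (by fun_prop)).mul hm.aestronglyMeasurable.comp_snd
    refine (integrable_prod_iff' hmeas).2 ⟨.of_forall fun s => ?_, ?_⟩
    · have q : Integrable fun t : ℝ => (Real.exp (-(2 * b) * (t + s / 2) ^ 2) : ℂ) :=
        (integrable_exp_neg_sq_add (b := 2 * b) (by positivity) (s / 2)).ofReal
      dsimp only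
      exact q.mul_const _
    · simp_rw [norm_mul (Complex.ofReal _), integral_mul_const]
      have h2 : ∀ s : ℝ, ∫ t : ℝ, ‖(Real.exp (-(2 * b) * (t + s / 2) ^ 2) : ℂ)‖ =
        (∫ t : ℝ, Real.exp (-(2 * b) * t ^ 2)) := fun s => by
        rw [← integral_add_right_eq_self (fun t : ℝ => Real.exp (-(2 * b) * t ^ 2)) (s / 2)]
        congr 1 with t
        rw [Complex.norm_real, Real.norm_eq_abs, Real.abs_exp]
      simp_rw [h2]
      exact hm.norm.const_mul _

/-- The Fourier transform of an integrable continuous positive-semidefinite function is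
real and non-negative. -/
theorem fourier_nonneg_of_inner_eq {H : Type*} [NormedAddCommGroup H] [InnerProductSpace ℂ H]
    [CompleteSpace H] {F : ℝ → ℂ} (hF : Continuous F) (hFi : Integrable F) {K : ℝ → H}
    (hK : ∀ t u, ⟪K t, K u⟫_ℂ = F (t - u)) (ξ : ℝ) :
    0 ≤ (𝓕 F ξ).re ∧ (𝓕 F ξ).im = 0 := by
  have hFm : Integrable fun s : ℝ => Complex.exp (-(2 * Real.pi * ξ * s * Complex.I)) * F s := by
    refine hFi.bdd_mul (c := 1) (Continuous.aestronglyMeasurable (by fun_prop))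
      (.of_forall fun s => ?_)
    rw [Complex.norm_exp]
    simp
  have hlim := Real.tendsto_integral_cexp_sq_smul hFm
  have hval : ∫ s : ℝ, Complex.exp (-(2 * Real.pi * ξ * s * Complex.I)) * F s = 𝓕 F ξ := by
    rw [Real.fourier_real_eq_integral_exp_smul]
    congr 1 with s
    rw [smul_eq_mul]
    congr 2
    push_cast
    ring
  rw [hval] at hlim
  have hc : ∀ c : ℝ, 0 < c →
      0 ≤ (∫ v : ℝ, Complex.exp (-(c⁻¹ : ℝ) * ‖v‖ ^ 2) •
        (Complex.exp (-(2 * Real.pi * ξ * v * Complex.I)) * F v)).re ∧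
      (∫ v : ℝ, Complex.exp (-(c⁻¹ : ℝ) * ‖v‖ ^ 2) •
        (Complex.exp (-(2 * Real.pi * ξ * v * Complex.I)) * F v)).im = 0 := fun c hc => by
    -- The choice `b = 2c⁻¹` makes the Gaussian weight `b / 2` equal to `c⁻¹`; the mean is then
    -- `‖v‖²` divided by a positive constant.
    have hb : 0 < 2 * c⁻¹ := by positivity
    have hg : Integrable fun u : ℝ =>
        (Real.exp (-(2 * c⁻¹) * u ^ 2) : ℂ) * Complex.exp (2 * Real.pi * ξ * u * Complex.I) := by
      refine (integrable_exp_neg_mul_sq hb).ofReal.mul_bdd (c := 1)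
        (Continuous.aestronglyMeasurable (by fun_prop)) (.of_forall fun s => ?_)
      rw [Complex.norm_exp]
      simp
    have e := (inner_self_integral_smul hF hK hg).trans
      (integral_integral_gaussian_kernel hFi _ hb ξ)
    have hpos : 0 < ∫ t : ℝ, Real.exp (-(2 * (2 * c⁻¹)) * t ^ 2) := by
      rw [integral_gaussian]
      positivity
    rw [mul_div_cancel_left₀ _ two_ne_zero, inner_self_eq_norm_sq_to_K] at e
    set v := ∫ t : ℝ, ((Real.exp (-(2 * c⁻¹) * t ^ 2) : ℂ) *
      Complex.exp (2 * Real.pi * ξ * t * Complex.I)) • K t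
    have er := congrArg Complex.re e
    have ei := congrArg Complex.im e
    rw [Complex.re_ofReal_mul] at er
    rw [Complex.im_ofReal_mul] at ei
    have en : ((algebraMap ℝ ℂ ‖v‖) ^ 2 : ℂ) = ((‖v‖ ^ 2 : ℝ) : ℂ) := by simp
    erw [en] at er ei
    rw [Complex.ofReal_re] at er
    rw [Complex.ofReal_im] at ei
    refine ⟨?_, ?_⟩
    · exact (mul_nonneg_iff_of_pos_left hpos).1 (er.symm ▸ sq_nonneg ‖v‖)
    · exact (mul_eq_zero.1 ei.symm).resolve_left hpos.ne'
  constructor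
  · refine ge_of_tendsto ((Complex.continuous_re.tendsto _).comp hlim) ?_
    filter_upwards [Ioi_mem_atTop 0] with c h
    simpa using (hc c h).1
  · refine tendsto_nhds_unique ((Complex.continuous_im.tendsto _).comp hlim)
      (tendsto_const_nhds.congr' ?_)
    filter_upwards [Ioi_mem_atTop 0] with c h
    simpa using (hc c h).2.symm

/-! ### Integrability of a non-negative Fourier transform -/

/-- The multiplication formula moves the transform onto the Gaussian, whose transform is an
approximate identity at `0`. -/
theorem tendsto_integral_gaussian_fourier {F : ℝ → ℂ} (hF : Continuous F) (hFi : Integrable F) :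
    Tendsto (fun c : ℝ => ∫ w : ℝ, Complex.exp (-c⁻¹ * ‖w‖ ^ 2) * 𝓕 F w) atTop (𝓝 (F 0)) := by
  refine (Real.tendsto_integral_gaussian_smul' hFi (hF.continuousAt (x := 0))).congr' ?_
  filter_upwards [Ioi_mem_atTop 0] with c (hc : 0 < c)
  have J : Integrable fun w : ℝ =>
        Complex.exp (-c⁻¹ * ‖w‖ ^ 2 + 2 * Real.pi * Complex.I * ⟪(0 : ℝ), w⟫_ℝ) :=
    GaussianFourier.integrable_cexp_neg_mul_sq_norm_add (by simpa) _ _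
  have e := integral_mul_fourier_eq hFi J
  simp only [inner_zero_left, Complex.ofReal_zero, mul_zero, add_zero] at e J
  rw [e]
  congr 1 with w
  have := fourier_gaussian_innerProductSpace' (V := ℝ) (b := (c : ℂ)⁻¹) (by simpa) 0 w
  simp only [inner_zero_left, Complex.ofReal_zero, mul_zero, add_zero] at this
  simp only [Complex.ofReal_inv]
  rw [this, smul_eq_mul]
  congr 2
  · simp
  · congr 1
    simp
    ring

/-- A continuous integrable function with non-negative Fourier transform has an integrable Fourier
transform. -/
theorem integrable_fourier_of_nonneg {F : ℝ → ℂ} (hF : Continuous F) (hFi : Integrable F)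
    (hpos : ∀ ξ, 0 ≤ (𝓕 F ξ).re ∧ (𝓕 F ξ).im = 0) : Integrable (𝓕 F) := by
  have hFc := continuous_fourier_of_integrable hFi
  have hlim := tendsto_integral_gaussian_fourier hF hFi
  let G : ℝ → ℝ → ℂ := fun c w => Complex.exp (-c⁻¹ * ‖w‖ ^ 2) * 𝓕 F w
  have hGc : ∀ c, Continuous (G c) := fun c => by fun_prop
  have hbound : ∀ ξ, ‖𝓕 F ξ‖ ≤ ∫ x, ‖F x‖ := fun ξ =>
    VectorFourier.norm_fourierIntegral_le_integral_norm _ _ _ _ _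
  have hGi : ∀ c, 0 < c → Integrable (G c) := fun c hc => by
    have J : Integrable fun w : ℝ =>
        Complex.exp (-c⁻¹ * ‖w‖ ^ 2 + 2 * Real.pi * Complex.I * ⟪(0 : ℝ), w⟫_ℝ) :=
      GaussianFourier.integrable_cexp_neg_mul_sq_norm_add (by simpa) _ _
    simp only [inner_zero_left, Complex.ofReal_zero, mul_zero, add_zero] at J
    exact J.mul_bdd hFc.aestronglyMeasurable (.of_forall hbound)
  have hGn : ∀ c w, ‖G c w‖ = (G c w).re := fun c w => by
    have e1 : 𝓕 F w = ((𝓕 F w).re : ℂ) := Complex.ext rfl (by simpa using (hpos w).2)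
    have e2 : Complex.exp (-c⁻¹ * ‖w‖ ^ 2) = (Real.exp (-c⁻¹ * ‖w‖ ^ 2) : ℂ) := by
      push_cast; rfl
    simp only [G]
    rw [e2, e1, ← Complex.ofReal_mul, Complex.norm_real, Complex.ofReal_re, Real.norm_eq_abs,
      abs_of_nonneg (mul_nonneg (Real.exp_pos _).le (hpos w).1)]
  have hlint : ∀ c, 0 < c → ∫⁻ w, ‖G c w‖ₑ = ENNReal.ofReal (∫ w, G c w).re := fun c hc => by
    have e3 : (∫ w, G c w).re = ∫ w, (G c w).re := (integral_re (hGi c hc)).symm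
    rw [← ofReal_integral_norm_eq_lintegral_enorm (hGi c hc), e3]
    simp_rw [hGn]
  have hre : Integrable fun w => (𝓕 F w).re := by
    -- Fatou: by non-negativity the `L¹` norms of the `G n` are their integrals, which converge to
    -- `F 0`.
    refine integrable_of_tendsto (G := fun n w => (G n w).re) (.of_forall fun w => ?_)
      (fun n => (Complex.continuous_re.comp (hGc n)).aestronglyMeasurable) ?_
    · have h0 : Tendsto (fun c : ℝ => Complex.exp (-((c⁻¹ : ℝ) : ℂ) * ‖w‖ ^ 2) * 𝓕 F w) atTop
          (𝓝 (Complex.exp (-((0 : ℝ) : ℂ) * ‖w‖ ^ 2) * 𝓕 F w)) := by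
        have hcont : Continuous fun x : ℝ => Complex.exp (-(x : ℂ) * ‖w‖ ^ 2) * 𝓕 F w := by
          fun_prop
        exact (hcont.tendsto 0).comp tendsto_inv_atTop_zero
      have h1 : Tendsto (fun c : ℝ => G c w) atTop (𝓝 (𝓕 F w)) := by simpa [G] using h0
      exact (Complex.continuous_re.tendsto _).comp (h1.comp tendsto_natCast_atTop_atTop)
    · have h1 : Tendsto (fun n : ℕ => ∫⁻ w, ‖(G n w).re‖ₑ) atTop
          (𝓝 (ENNReal.ofReal (F 0).re)) := by
        refine ((ENNReal.continuous_ofReal.tendsto _).comp ((Complex.continuous_re.tendsto _).comp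
          (hlim.comp tendsto_natCast_atTop_atTop))).congr' ?_
        filter_upwards [Ioi_mem_atTop 0] with n hn
        refine (hlint n (by exact_mod_cast hn)).symm.trans (lintegral_congr fun w => ?_)
        rw [← hGn, enorm_norm]
      rw [h1.liminf_eq]
      exact ENNReal.ofReal_ne_top
  refine hre.ofReal.congr (.of_forall fun w => ?_)
  exact Complex.ext rfl (by simpa using (hpos w).2.symm)

/-! ### Isometries from equal Gram matrices -/

/-- Two families with dense spans and the same Gram matrix are related by an isometry. -/
theorem exists_linearIsometryEquiv_of_inner_eq {ι E F : Type*}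
    [NormedAddCommGroup E] [InnerProductSpace ℂ E] [CompleteSpace E]
    [NormedAddCommGroup F] [InnerProductSpace ℂ F] [CompleteSpace F]
    (a : ι → E) (b : ι → F) (hab : ∀ i j, ⟪a i, a j⟫_ℂ = ⟪b i, b j⟫_ℂ)
    (ha : (Submodule.span ℂ (Set.range a)).topologicalClosure = ⊤)
    (hb : (Submodule.span ℂ (Set.range b)).topologicalClosure = ⊤) :
    ∃ U : E ≃ₗᵢ[ℂ] F, ∀ i, U (a i) = b i := by
  have hda : DenseRange (Finsupp.linearCombination ℂ a) := by
    have := Submodule.dense_iff_topologicalClosure_eq_top.2 ha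
    rwa [← Finsupp.range_linearCombination] at this
  have hdb : DenseRange (Finsupp.linearCombination ℂ b) := by
    have := Submodule.dense_iff_topologicalClosure_eq_top.2 hb
    rwa [← Finsupp.range_linearCombination] at this
  -- The norm of a finite combination depends only on the Gram matrix.
  have hn : ∀ x : ι →₀ ℂ, ‖Finsupp.linearCombination ℂ b (LinearEquiv.refl ℂ _ x)‖ =
      ‖Finsupp.linearCombination ℂ a x‖ := fun x => by
    rw [@norm_eq_sqrt_re_inner ℂ, @norm_eq_sqrt_re_inner ℂ]
    simp only [LinearEquiv.refl_apply, Finsupp.linearCombination_apply, Finsupp.sum_inner,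
      Finsupp.inner_sum, inner_smul_left, inner_smul_right, hab]
  refine ⟨(LinearEquiv.refl ℂ (ι →₀ ℂ)).extendOfIsometry _ _ hda hdb hn, fun i => ?_⟩
  have := LinearMap.extendOfNorm_eq (f := (Finsupp.linearCombination ℂ b))
    hda ⟨1, fun x => by rw [one_mul]; exact (hn x).le⟩ (Finsupp.single i 1)
  simpa using! this

/-! ### Convolution with `h` as an inner product in `L²` -/

theorem memLp_conj_comp_sub_left {h : ℝ → ℂ} (hh : MemLp h 2 volume) (t : ℝ) :
    MemLp (fun τ => conj (h (t - τ))) 2 volume :=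
  (hh.comp_measurePreserving (Measure.measurePreserving_sub_left volume t)).star

/-- The element `τ ↦ conj (h (t - τ))` of `L²`. -/
noncomputable def reflectedTranslate {h : ℝ → ℂ} (hh : MemLp h 2 (volume : Measure ℝ)) (t : ℝ) :
    Lp ℂ 2 (volume : Measure ℝ) :=
  (memLp_conj_comp_sub_left hh t).toLp _

theorem coeFn_reflectedTranslate {h : ℝ → ℂ} (hh : MemLp h 2 volume) (t : ℝ) :
    reflectedTranslate hh t =ᵐ[volume] fun τ => conj (h (t - τ)) :=
  MemLp.coeFn_toLp _

theorem fourier_conj_mul_exp (g : ℝ → ℂ) (t τ : ℝ) :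
    𝓕 (fun ξ : ℝ => conj (g ξ) * Complex.exp (2 * Real.pi * t * ξ * Complex.I)) τ =
      conj (𝓕 g (t - τ)) := by
  rw [Real.fourier_real_eq_integral_exp_smul, Real.fourier_real_eq_integral_exp_smul,
    ← integral_conj]
  congr 1 with ξ
  simp only [smul_eq_mul, map_mul, ← Complex.exp_conj, Complex.conj_ofReal, Complex.conj_I]
  rw [mul_left_comm, ← Complex.exp_add, mul_comm]
  congr 2
  push_cast
  ring

theorem norm_exp_two_pi_mul_I (t ξ : ℝ) :
    ‖Complex.exp (2 * Real.pi * t * ξ * Complex.I)‖ = 1 := by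
  rw [Complex.norm_exp]
  simp

theorem memLp_exp_mul {p : ENNReal} {f : ℝ → ℂ} (hf : MemLp f p volume) (t : ℝ) :
    MemLp (fun ξ : ℝ => f ξ * Complex.exp (2 * Real.pi * t * ξ * Complex.I)) p volume := by
  refine hf.of_le (hf.aestronglyMeasurable.mul (Continuous.aestronglyMeasurable (by fun_prop)))
    (.of_forall fun ξ => ?_)
  rw [norm_mul, norm_exp_two_pi_mul_I, mul_one]

/-- Tested against a Schwartz `φ`, the claim becomes the `L²` multiplication formula for `h` and the
modulated function `conj φ`. -/
theorem fourier_reflectedTranslate {h : ℝ → ℂ} (hh : MemLp h 2 volume) (t : ℝ) :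
    (𝓕 (reflectedTranslate hh t) : Lp ℂ 2 (volume : Measure ℝ)) =ᵐ[volume] fun ξ =>
      conj ((𝓕 (hh.toLp h) : Lp ℂ 2 (volume : Measure ℝ)) ξ *
        Complex.exp (2 * Real.pi * t * ξ * Complex.I)) := by
  have hm := (memLp_exp_mul (Lp.memLp (𝓕 (hh.toLp h) : Lp ℂ 2 (volume : Measure ℝ))) t).star
  refine ae_eq_of_integral_schwartz_mul_eq (locallyIntegrable_L2 _)
    (hm.locallyIntegrable (by norm_num)) fun φ => ?_
  have hG1 : Integrable fun ξ : ℝ =>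
      conj (φ ξ) * Complex.exp (2 * Real.pi * t * ξ * Complex.I) :=
    memLp_one_iff_integrable.1 (memLp_exp_mul (φ.memLp 1).star t)
  have hG2 : MemLp (fun ξ : ℝ =>
      conj (φ ξ) * Complex.exp (2 * Real.pi * t * ξ * Complex.I)) 2 volume :=
    memLp_exp_mul (φ.memLp 2).star t
  have key := integral_mul_fourierL2_eq (hh.toLp h) (hG2.toLp _)
  rw [integral_schwartz_mul_fourierL2]
  calc ∫ x, 𝓕 (φ : ℝ → ℂ) x * reflectedTranslate hh t x
      = ∫ x, 𝓕 (φ : ℝ → ℂ) x * conj (h (t - x)) := by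
        refine integral_congr_ae ?_
        filter_upwards [coeFn_reflectedTranslate hh t] with x hx
        rw [hx]
    _ = ∫ x, 𝓕 (φ : ℝ → ℂ) (t - x) * conj (h x) := by
        rw [← integral_sub_left_eq_self _ volume t]
        simp
    _ = conj (∫ x, (𝓕 (hG2.toLp _) : Lp ℂ 2 (volume : Measure ℝ)) x * hh.toLp h x) := by
        rw [← integral_conj]
        refine integral_congr_ae ?_
        filter_upwards [hh.coeFn_toLp, fourier_ae_eq_fourierL2 hG1 hG2] with x hx hx'
        rw [← hx', hx, fourier_conj_mul_exp]
        simp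
    _ = _ := by
        rw [← key, ← integral_conj]
        refine integral_congr_ae ?_
        filter_upwards [hG2.coeFn_toLp] with x hx
        rw [hx]
        simp
        ring

theorem integrable_mul_of_L2 (f g : Lp ℂ 2 (volume : Measure ℝ)) :
    Integrable fun x => f x * g x :=
  (Lp.memLp f).integrable_mul (Lp.memLp g)

theorem convolve_eq_inner {h : ℝ → ℂ} (hh : MemLp h 2 volume) (f : Lp ℂ 2 (volume : Measure ℝ))
    (t : ℝ) : convolve h f t = ⟪reflectedTranslate hh t, f⟫_ℂ := by
  rw [L2.inner_def, convolve]
  refine integral_congr_ae ?_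
  filter_upwards [coeFn_reflectedTranslate hh t] with x hx
  rw [hx]
  simp [mul_comm]

theorem integrable_convolve_integrand {h : ℝ → ℂ} (hh : MemLp h 2 volume)
    (f : Lp ℂ 2 (volume : Measure ℝ)) (t : ℝ) : Integrable fun τ => h (t - τ) * f τ :=
  (hh.comp_measurePreserving (Measure.measurePreserving_sub_left volume t)).integrable_mul (Lp.memLp f)

/-- Plancherel applied to `⟪k_t, f⟫`. The product of two `L²` functions is integrable, so the
identity holds at every `t`, not just almost everywhere. -/
theorem convolve_eq_fourierInv {h : ℝ → ℂ} (hh : MemLp h 2 volume)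
    (f : Lp ℂ 2 (volume : Measure ℝ)) (t : ℝ) :
    convolve h f t = 𝓕⁻ (fun ξ => (𝓕 (hh.toLp h) : Lp ℂ 2 (volume : Measure ℝ)) ξ *
      (𝓕 f : Lp ℂ 2 (volume : Measure ℝ)) ξ) t := by
  rw [convolve_eq_inner hh, ← Lp.inner_fourier_eq, L2.inner_def, Real.fourierInv_eq']
  refine integral_congr_ae ?_
  filter_upwards [fourier_reflectedTranslate hh t] with ξ hξ
  rw [hξ]
  simp only [RCLike.inner_apply, Complex.conj_conj, smul_eq_mul]
  rw [mul_comm, mul_comm _ (Complex.exp _), mul_assoc]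
  congr 2
  simp
  ring

theorem inner_reflectedTranslate {h : ℝ → ℂ} (hh : MemLp h 2 volume) (t u : ℝ) :
    ⟪reflectedTranslate hh t, reflectedTranslate hh u⟫_ℂ =
      𝓕⁻ (fun ξ => ((‖(𝓕 (hh.toLp h) : Lp ℂ 2 (volume : Measure ℝ)) ξ‖ ^ 2 : ℝ) : ℂ)) (t - u) := by
  rw [← Lp.inner_fourier_eq, L2.inner_def, Real.fourierInv_eq']
  refine integral_congr_ae ?_
  filter_upwards [fourier_reflectedTranslate hh t, fourier_reflectedTranslate hh u] with ξ h1 h2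
  rw [h1, h2]
  rw [RCLike.inner_apply, smul_eq_mul, Complex.ofReal_pow, ← Complex.mul_conj']
  have : Complex.exp (((2 * Real.pi * inner ℝ ξ (t - u) : ℝ) : ℂ) * Complex.I) =
      Complex.exp (2 * Real.pi * t * ξ * Complex.I) *
        Complex.exp (2 * Real.pi * u * ξ * -Complex.I) := by
    rw [← Complex.exp_add]
    congr 1
    simp
    ring
  rw [this]
  simp only [Complex.conj_conj, map_mul, ← Complex.exp_conj,
    Complex.conj_ofReal, Complex.conj_I, map_ofNat, map_neg, neg_neg]
  ring

/-- If `ĥ` vanishes almost nowhere, the functions `τ ↦ conj (h (t - τ))` span a dense subspace. -/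
theorem span_reflectedTranslate_dense {h : ℝ → ℂ} (hh : MemLp h 2 volume)
    (hne : ∀ᵐ ξ, (𝓕 (hh.toLp h) : Lp ℂ 2 (volume : Measure ℝ)) ξ ≠ 0)
    (hL2 : ∀ f : Lp ℂ 2 (volume : Measure ℝ),
      MemLp (fun ξ => (𝓕 (hh.toLp h) : Lp ℂ 2 (volume : Measure ℝ)) ξ * f ξ) 2 volume) :
    (Submodule.span ℂ (Set.range (reflectedTranslate hh))).topologicalClosure = ⊤ := by
  refine Submodule.orthogonal_eq_bot_iff.mp ((Submodule.eq_bot_iff _).2 fun f hf => ?_)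
  -- Orthogonality to every translate means `h * f = 0`, hence `ĥ f̂ = 0`, and `ĥ ≠ 0` a.e. forces
  -- `f = 0`.
  have h0 : ∀ t, convolve h f t = 0 := fun t => by
    rw [convolve_eq_inner hh]
    exact Submodule.inner_right_of_mem_orthogonal
      (Submodule.le_topologicalClosure _ (Submodule.subset_span (Set.mem_range_self t))) hf
  have h1 := fourierInv_ae_eq_fourierInvL2 (integrable_mul_of_L2 (𝓕 (hh.toLp h)) (𝓕 f))
    (hL2 (𝓕 f))
  have h2 : (𝓕⁻ ((hL2 (𝓕 f)).toLp _) : Lp ℂ 2 (volume : Measure ℝ)) = 0 := by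
    refine (Lp.eq_zero_iff_ae_eq_zero).2 (h1.symm.trans (.of_forall fun t => ?_))
    rw [← convolve_eq_fourierInv, h0]
    rfl
  have h3 : (hL2 (𝓕 f)).toLp _ = 0 :=
    (Lp.fourierTransformₗᵢ ℝ ℂ).symm.map_eq_zero_iff.1 h2
  have h4 : 𝓕 f = 0 := by
    refine (Lp.eq_zero_iff_ae_eq_zero).2 ?_
    filter_upwards [(hL2 (𝓕 f)).coeFn_toLp, (Lp.eq_zero_iff_ae_eq_zero).1 h3, hne] with ξ a b c
    rw [b] at a
    exact (mul_eq_zero.1 a.symm).resolve_left c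
  exact (Lp.fourierTransformₗᵢ ℝ ℂ).map_eq_zero_iff.1 h4

theorem fourier_convolve {h : ℝ → ℂ} (hh : MemLp h 2 volume) (f : Lp ℂ 2 (volume : Measure ℝ))
    (hL2 : MemLp (fun ξ => (𝓕 (hh.toLp h) : Lp ℂ 2 (volume : Measure ℝ)) ξ *
      (𝓕 f : Lp ℂ 2 (volume : Measure ℝ)) ξ) 2 volume) :
    ∃ hc : MemLp (convolve h f) 2 volume,
      (𝓕 (hc.toLp _) : Lp ℂ 2 (volume : Measure ℝ)) =ᵐ[volume] fun ξ =>
        (𝓕 (hh.toLp h) : Lp ℂ 2 (volume : Measure ℝ)) ξ *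
          (𝓕 f : Lp ℂ 2 (volume : Measure ℝ)) ξ := by
  have h1 := fourierInv_ae_eq_fourierInvL2 (integrable_mul_of_L2 (𝓕 (hh.toLp h)) (𝓕 f)) hL2
  have h2 : convolve h f =ᵐ[volume] (𝓕⁻ (hL2.toLp _) : Lp ℂ 2 (volume : Measure ℝ)) := by
    filter_upwards [h1] with t ht
    rw [← ht, convolve_eq_fourierInv hh]
  have hc : MemLp (convolve h f) 2 volume := (memLp_congr_ae h2).2 (Lp.memLp _)
  refine ⟨hc, ?_⟩
  have h3 : hc.toLp _ = (𝓕⁻ (hL2.toLp _) : Lp ℂ 2 (volume : Measure ℝ)) :=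
    Lp.ext (hc.coeFn_toLp.trans h2)
  rw [h3, fourier_fourierInv_eq]
  exact hL2.coeFn_toLp

/-! ### Passage to the normalisation `e^{-iωt}` -/

theorem fourierL1_eq (f : ℝ → ℂ) (ω : ℝ) : fourierL1 f ω = 𝓕 f (ω / (2 * Real.pi)) := by
  rw [Real.fourier_real_eq_integral_exp_smul, fourierL1]
  congr 1 with t
  rw [smul_eq_mul, mul_comm]
  congr 2
  push_cast
  field_simp [Real.pi_ne_zero]

theorem ae_comp_mul_right {P : ℝ → Prop} {c : ℝ} (hc : c ≠ 0) (h : ∀ᵐ x : ℝ, P x) :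
    ∀ᵐ x : ℝ, P (x * c) := by
  have : Measure.QuasiMeasurePreserving (fun x : ℝ => x * c) volume volume :=
    ⟨by fun_prop, by
      rw [Real.map_volume_mul_right hc]
      exact Measure.smul_absolutelyContinuous⟩
  exact this.ae h

theorem ae_comp_div_two_pi {P : ℝ → Prop} (h : ∀ᵐ x : ℝ, P x) :
    ∀ᵐ x : ℝ, P (x / (2 * Real.pi)) := by
  simpa only [div_eq_mul_inv] using
    ae_comp_mul_right (c := (2 * Real.pi)⁻¹) (inv_ne_zero Real.two_pi_pos.ne') h

theorem ae_of_ae_comp_div_two_pi {P : ℝ → Prop} (h : ∀ᵐ x : ℝ, P (x / (2 * Real.pi))) :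
    ∀ᵐ x : ℝ, P x := by
  filter_upwards [ae_comp_mul_right Real.two_pi_pos.ne' h] with x hx
  rwa [mul_div_cancel_right₀ _ Real.two_pi_pos.ne'] at hx

theorem fourierHat_of_integrable {f : ℝ → ℂ} (hf : Integrable f) (ω : ℝ) :
    fourierHat f ω = 𝓕 f (ω / (2 * Real.pi)) := by
  rw [fourierHat, if_pos hf, fourierL1_eq]

/-- On `L¹ ∩ L²` the definition of `fourierHat` takes the `L¹` branch, so the equality is only
almost everywhere. -/
theorem fourierHat_ae_eq {f : ℝ → ℂ} (hf : MemLp f 2 volume) :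
    ∀ᵐ ω : ℝ, fourierHat f ω =
      (𝓕 (hf.toLp f) : Lp ℂ 2 (volume : Measure ℝ)) (ω / (2 * Real.pi)) := by
  by_cases hi : Integrable f
  · filter_upwards [ae_comp_div_two_pi (fourier_ae_eq_fourierL2 hi hf)] with ω hω
    rw [fourierHat_of_integrable hi, hω]
  · refine .of_forall fun ω => ?_
    rw [fourierHat, if_neg hi, dif_pos hf, fourierL2]

/-! ### Kernel functions of the RKHS -/

theorem inner_kerFun_one {r : Matrix ℝ ℝ ℝ} (hr : r.PosSemidef) {H : Type*}
    [NormedAddCommGroup H] [InnerProductSpace ℂ H] [CompleteSpace H] [RKHS ℂ H ℝ ℂ]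
    (hH : RKHS.kernel H = complexKernel r) (t u : ℝ) :
    ⟪RKHS.kerFun H t 1, RKHS.kerFun H u 1⟫_ℂ = (r t u : ℂ) := by
  rw [← RKHS.kernel_inner, hH]
  simp only [complexKernel, Matrix.of_apply]
  simpa using hr.isHermitian.apply t u

theorem span_kerFun_one_dense (H : Type*)
    [NormedAddCommGroup H] [InnerProductSpace ℂ H] [CompleteSpace H] [RKHS ℂ H ℝ ℂ] :
    (Submodule.span ℂ (Set.range fun t : ℝ => RKHS.kerFun H t (1 : ℂ))).topologicalClosure = ⊤ := by
  rw [← top_le_iff, ← RKHS.kerFun_dense H]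
  refine Submodule.topologicalClosure_mono (Submodule.span_le.2 ?_)
  rintro _ ⟨t, v, rfl⟩
  have : RKHS.kerFun H t v = v • RKHS.kerFun H t (1 : ℂ) := by
    rw [← map_smul, smul_eq_mul, mul_one]
  rw [this]
  exact Submodule.smul_mem _ _ (Submodule.subset_span ⟨t, rfl⟩)

end

open scoped InnerProductSpace

/-! ### The main theorem -/

theorem theorem1 {I : Type*} (Φ : ℝ → ℝ) (r : Matrix ℝ ℝ ℝ)
    (hrΦ : ∀ t u : ℝ, r t u = Φ (t - u)) (hr : r.PosSemidef)
    (hΦc : Continuous Φ) (hΦi : Integrable Φ (volume : Measure ℝ))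
    (hΦpos : ∀ᵐ ω : ℝ, fourierHat (fun t => (Φ t : ℂ)) ω ≠ 0)
    (φ : HilbertBasis I ℂ (Lp ℂ 2 (volume : Measure ℝ)))
    (h : ℝ → ℂ)
    (hh : Integrable h (volume : Measure ℝ) ∨ MemLp h 2 (volume : Measure ℝ))
    (hhΦ : ∀ᵐ ω : ℝ, ‖fourierHat h ω‖ = √(fourierHat (fun t => (Φ t : ℂ)) ω).re) :
    -- the integrals defining `ψ_m(t) = ∫ h(t - τ) φ_m(τ) dτ` converge absolutely for every `t`
    (∀ (m : I) (t : ℝ), Integrable (fun τ => h (t - τ) * φ m τ) (volume : Measure ℝ)) ∧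
    -- `ψ_m` is square-integrable with Fourier transform `ĥ φ̂_m`
    (∀ m : I, MemLp (convolve h (φ m)) 2 (volume : Measure ℝ) ∧
      ∀ᵐ ω : ℝ, fourierHat (convolve h (φ m)) ω = fourierHat h ω * fourierHat (φ m) ω) ∧
    -- the `ψ_m` form an orthonormal basis of the reproducing kernel Hilbert space of `r`
    (∀ (H : Type*) [NormedAddCommGroup H] [InnerProductSpace ℂ H] [CompleteSpace H]
      [RKHS ℂ H ℝ ℂ], RKHS.kernel H = complexKernel r →
      ∃ ψ : HilbertBasis I ℂ H, ∀ (m : I) (t : ℝ), ψ m t = convolve h (φ m) t) ∧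
    -- pointwise convergent expansion of the kernel
    (∀ t u : ℝ, HasSum (fun m : I => conj (convolve h (φ m) t) * convolve h (φ m) u)
      (r t u : ℂ)) := by

  set F : ℝ → ℂ := fun t => (Φ t : ℂ) with hFdef
  have hFc : Continuous F := Complex.continuous_ofReal.comp hΦc
  have hFi : Integrable F := hΦi.ofReal
  have hFpos : ∀ ξ, 0 ≤ (𝓕 F ξ).re ∧ (𝓕 F ξ).im = 0 := by
    -- Any Hilbert space realising the kernel as a Gram matrix serves here.
    obtain ⟨H, _, _, _, _, hH⟩ := exists_rkhs hr
    exact fourier_nonneg_of_inner_eq hFc hFi (K := fun t => RKHS.kerFun H t (1 : ℂ))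
      fun t u => by rw [inner_kerFun_one hr hH, hrΦ]
  have hFhat := integrable_fourier_of_nonneg hFc hFi hFpos
  simp_rw [fourierHat_of_integrable hFi] at hΦpos hhΦ
  have hF0 : ∀ᵐ ξ, 𝓕 F ξ ≠ 0 := ae_of_ae_comp_div_two_pi hΦpos
  have hh2 : MemLp h 2 volume := by
    rcases hh with hi | h2
    · simp_rw [fourierHat_of_integrable hi] at hhΦ
      have hn : ∀ᵐ ξ, ‖𝓕 h ξ‖ = √(𝓕 F ξ).re := ae_of_ae_comp_div_two_pi hhΦ
      -- `|ĥ|² = Φ̂` is integrable, so `ĥ`, and with it `h`, is in `L²`.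
      refine memLp_two_of_fourier_memLp hi ((memLp_two_iff_integrable_sq_norm
        (continuous_fourier_of_integrable hi).aestronglyMeasurable).2 (hFhat.re.congr ?_))
      filter_upwards [hn] with ξ hξ
      rw [hξ, Real.sq_sqrt (hFpos ξ).1]
      rfl
    · exact h2
  have hnorm : ∀ᵐ ξ, ‖(𝓕 (hh2.toLp h) : Lp ℂ 2 (volume : Measure ℝ)) ξ‖ = √(𝓕 F ξ).re := by
    refine ae_of_ae_comp_div_two_pi ?_
    filter_upwards [hhΦ, fourierHat_ae_eq hh2] with ω h1 h2
    rw [← h2, h1]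
  have hbound : ∀ ξ, ‖𝓕 F ξ‖ ≤ ∫ x, ‖F x‖ := fun ξ =>
    VectorFourier.norm_fourierIntegral_le_integral_norm _ _ _ _ _
  have hL2 : ∀ f : Lp ℂ 2 (volume : Measure ℝ),
      MemLp (fun ξ => (𝓕 (hh2.toLp h) : Lp ℂ 2 (volume : Measure ℝ)) ξ * f ξ) 2 volume := by
    intro f
    -- The constant comes from `|ĥ|² = Φ̂ ≤ ‖Φ‖₁`.
    refine (Lp.memLp f).of_le_mul (c := √(∫ x, ‖F x‖))
      ((Lp.aestronglyMeasurable _).mul (Lp.aestronglyMeasurable _)) ?_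
    filter_upwards [hnorm] with ξ hξ
    rw [norm_mul, hξ]
    gcongr
    exact (Complex.re_le_norm _).trans (hbound ξ)
  have hne : ∀ᵐ ξ, (𝓕 (hh2.toLp h) : Lp ℂ 2 (volume : Measure ℝ)) ξ ≠ 0 := by
    filter_upwards [hF0, hnorm] with ξ h0 h1 h2
    rw [h2, norm_zero, eq_comm, Real.sqrt_eq_zero (hFpos ξ).1] at h1
    exact h0 (Complex.ext h1 (hFpos ξ).2)
  have hgram : ∀ t u, ⟪reflectedTranslate hh2 t, reflectedTranslate hh2 u⟫_ℂ = (r t u : ℂ) := by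
    intro t u
    have hinv : 𝓕⁻ (𝓕 F) (t - u) = F (t - u) :=
      hFi.fourierInv_fourier_eq hFhat hFc.continuousAt
    rw [inner_reflectedTranslate, hrΦ]
    refine Eq.trans ?_ hinv
    rw [Real.fourierInv_eq, Real.fourierInv_eq]
    refine integral_congr_ae ?_
    filter_upwards [hnorm] with ξ hξ
    rw [hξ, Real.sq_sqrt (hFpos ξ).1]
    congr 1
    exact Complex.ext rfl (by simpa using (hFpos ξ).2.symm)
  refine ⟨fun m t => integrable_convolve_integrand hh2 (φ m) t, fun m => ?_, ?_, fun t u => ?_⟩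
  · obtain ⟨hc, hcF⟩ := fourier_convolve hh2 (φ m) (hL2 _)
    refine ⟨hc, ?_⟩
    filter_upwards [fourierHat_ae_eq hc, fourierHat_ae_eq hh2, fourierHat_ae_eq (Lp.memLp (φ m)),
      ae_comp_div_two_pi hcF] with ω h1 h2 h3 h4
    rw [h1, h2, h3, h4, Lp.toLp_coeFn]
  · intro H _ _ _ _ hH
    obtain ⟨U, hU⟩ := exists_linearIsometryEquiv_of_inner_eq (reflectedTranslate hh2)
      (fun t : ℝ => RKHS.kerFun H t (1 : ℂ))
      (fun t u => by rw [hgram, inner_kerFun_one hr hH])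
      (span_reflectedTranslate_dense hh2 hne hL2) (span_kerFun_one_dense H)
    have hψ : ∀ m, HilbertBasis.ofRepr (U.symm.trans φ.repr) m = U (φ m) := fun m => by
      classical
      rw [← HilbertBasis.repr_symm_single, ← HilbertBasis.repr_symm_single]
      rfl
    refine ⟨HilbertBasis.ofRepr (U.symm.trans φ.repr), fun m t => ?_⟩
    -- Reproducing property: `(U φ_m)(t) = ⟪U k_t, U φ_m⟫ = ⟪k_t, φ_m⟫`.
    have h1 := RKHS.kerFun_inner t (1 : ℂ) (U (φ m))
    rw [← hU, U.inner_map_map, ← convolve_eq_inner] at h1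
    rw [hψ, h1]
    simp
  · have h1 := φ.hasSum_inner_mul_inner (reflectedTranslate hh2 u) (reflectedTranslate hh2 t)
    rw [hgram, show r u t = r t u by simpa using (hr.isHermitian.apply t u)] at h1
    refine h1.congr_fun ?_
    intro m
    rw [convolve_eq_inner hh2, convolve_eq_inner hh2, inner_conj_symm, mul_comm]
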